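/- Let $d\ge 1$, let $c(x,y)=\tfrac12\|x-y\|^2$ on $\mathbb R^d\times\mathbb R^d$, and let $\mu_0,\mu_1$ be Borel probability measures on $\mathbb R^d$ with finite second moments. Let $(\varphi,\psi)$ be a pair of Kantorovich potentials, that is, functions $\varphi,\psi:\mathbb R^d\to[-\infty,\infty)$ with $\varphi\in L^1(\mu_0)$, $\psi\in L^1(\mu_1)$ which are $c$-transforms of each other, $\varphi(x)=\inf_y\big(c(x,y)-\psi(y)\big)$ and $\psi(y)=\inf_x\big(c(x,y)-\varphi(x)\big)$ for all $x,y\in\mathbb R^d$, and which maximize $\int\varphi\,d\mu_0+\int\psi\,d\mu_1$ among all integrable pairs with $\varphi(x)+\psi(y)\le c(x,y)$ for all $x,y$ (for instance real-valued continuous ones). Let $E(x,y)=c(x,y)-\varphi(x)-\psi(y)\in[0,\infty]$ be the duality gap, and let $\gamma_0$ be any optimal transport plan from $\mu_0$ to $\mu_1$ for the cost $c$. For a probability measure $\mu$ on $\mathbb R^k$ with Lebesgue density $\rho$, let $H(\mu)=\int\rho\ln\rho\in[-\infty,\infty]$, read as $+\infty$ if $\int\rho\,(\ln\rho)^+=\infty$,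 and let $N_k(\mu)=\frac1{2\pi e}e^{-\frac2kH(\mu)}\in[0,\infty]$. For a probability measure $\gamma$ on $\mathbb R^{2d}=\mathbb R^d\times\mathbb R^d$, let $\hat\mu$ be the law of $\frac1{\sqrt2}(X+Y)$ and $\sigma_\gamma(X+Y)=\big(\mathbb E\|X+Y-\mathbb E(X+Y)\|^2\big)^{1/2}$ (equal to $\infty$ if $X+Y$ is not square integrable) when $(X,Y)$ has law $\gamma$. Let $W_2$ be the 2-Wasserstein distance on $\mathbb R^{2d}$ for the Euclidean norm, with values in $[0,\infty]$, and let $C_d=-\frac d2\ln\frac{4\pi e}{d}$. Then for every absolutely continuous probability measure $\gamma$ on $\mathbb R^{2d}$, $$H(\gamma)\ \ge\ -\frac d2\ln\Big(\int E\,d\gamma\Big)+H(\hat\mu)+C_d,\qquad H(\gamma)\ \ge\ -\frac d2\ln W_2^2(\gamma,\gamma_0)+H(\hat\mu)+C_d,$$ where the right-hand side is read as $-\infty$ if $\int E\,d\gamma=\infty$, respectively $W_2(\gamma,\gamma_0)=\infty$. Moreover $$N_{2d}(\gamma)\ \le\ \frac{\sigma_\gamma(X+Y)}{d}\sqrt{\int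 E\,d\gamma},\qquad N_{2d}(\gamma)\ \le\ \frac{\sigma_\gamma(X+Y)}{d}\,W_2(\gamma,\gamma_0).$$ -/

import Mathlib

open MeasureTheory
open scoped ENNReal

noncomputable section

namespace QuadraticOT

/-- The space `ℝ^d` with its Euclidean norm. -/
abbrev Rd (d : ℕ) : Type := EuclideanSpace ℝ (Fin d)

/-- Probability measures on `ℝ^d` with finite second moment. -/
def IsP2 {d : ℕ} (μ : Measure (Rd d)) : Prop :=
  IsProbabilityMeasure μ ∧ MemLp (fun x : Rd d => x) 2 μ

/-- The quadratic cost `c(x, y) = ‖x - y‖² / 2`. -/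
def quadCost {d : ℕ} (x y : Rd d) : ℝ := ‖x - y‖ ^ 2 / 2

/-- `π` is a transport plan from `μ` to `ν`: it has marginals `μ` and `ν`. -/
def IsPlan {X Y : Type*} [MeasurableSpace X] [MeasurableSpace Y]
    (μ : Measure X) (ν : Measure Y) (π : Measure (X × Y)) : Prop :=
  π.fst = μ ∧ π.snd = ν

/-- `γ₀` is an optimal transport plan from `μ₀` to `μ₁` for the quadratic cost. -/
def IsOptimalPlan {d : ℕ} (μ₀ μ₁ : Measure (Rd d)) (γ₀ : Measure (Rd d × Rd d)) : Prop :=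
  IsPlan μ₀ μ₁ γ₀ ∧ ∀ π : Measure (Rd d × Rd d), IsPlan μ₀ μ₁ π →
    ∫⁻ p, ENNReal.ofReal (quadCost p.1 p.2) ∂γ₀ ≤ ∫⁻ p, ENNReal.ofReal (quadCost p.1 p.2) ∂π

/-- The squared Euclidean distance on `ℝ^{2d} = ℝ^d × ℝ^d` (the distance that Lean puts on a
product type is the maximum distance, hence the explicit formula). -/
def sqDist2d {d : ℕ} (z w : Rd d × Rd d) : ℝ := ‖z.1 - w.1‖ ^ 2 + ‖z.2 - w.2‖ ^ 2

/-- The squared 2-Wasserstein distance between measures on `ℝ^{2d}`, with values in `[0, ∞]`. -/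
def W2sq {d : ℕ} (γ γ' : Measure (Rd d × Rd d)) : ℝ≥0∞ :=
  ⨅ (π : Measure ((Rd d × Rd d) × (Rd d × Rd d))) (_ : IsPlan γ γ' π),
    ∫⁻ q, ENNReal.ofReal (sqDist2d q.1 q.2) ∂π

/-- The 2-Wasserstein distance between measures on `ℝ^{2d}`, with values in `[0, ∞]`. -/
def W2 {d : ℕ} (γ γ' : Measure (Rd d × Rd d)) : ℝ≥0∞ := W2sq γ γ' ^ (1 / 2 : ℝ)

/-- Kantorovich potentials for the quadratic cost: integrable functions with values in `[-∞, ∞)`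
that are `c`-transforms of each other and maximize `∫ φ dμ₀ + ∫ ψ dμ₁` under the constraint
`φ(x) + ψ(y) ≤ c(x, y)`. The value `-∞` is allowed on null sets because it cannot be avoided for a
mutual `c`-transform pair on the whole space, e.g. from a Gaussian to a measure of compact support;
real-valued continuous potentials are a special case. -/
structure IsKantorovichPair {d : ℕ} (μ₀ μ₁ : Measure (Rd d)) (φ ψ : Rd d → EReal) : Prop where
  left_ne_top : ∀ x, φ x ≠ ⊤
  right_ne_top : ∀ y, ψ y ≠ ⊤
  left_ne_bot : ∀ᵐ x ∂μ₀, φ x ≠ ⊥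
  right_ne_bot : ∀ᵐ y ∂μ₁, ψ y ≠ ⊥
  left_integrable : Integrable (fun x => (φ x).toReal) μ₀
  right_integrable : Integrable (fun y => (ψ y).toReal) μ₁
  left_eq : ∀ x, φ x = ⨅ y, ((quadCost x y : ℝ) : EReal) - ψ y
  right_eq : ∀ y, ψ y = ⨅ x, ((quadCost x y : ℝ) : EReal) - φ x
  maximal : ∀ φ' ψ' : Rd d → ℝ, Integrable φ' μ₀ → Integrable ψ' μ₁ →
    (∀ x y, φ' x + ψ' y ≤ quadCost x y) →
    ∫ x, φ' x ∂μ₀ + ∫ y, ψ' y ∂μ₁ ≤ ∫ x, (φ x).toReal ∂μ₀ + ∫ y, (ψ y).toReal ∂μ₁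

/-- The duality gap `E(x, y) = c(x, y) - (φ(x) + ψ(y))`, with values in `[0, ∞]` for a pair of
Kantorovich potentials. -/
def dualityGap {d : ℕ} (φ ψ : Rd d → EReal) (x y : Rd d) : EReal :=
  ((quadCost x y : ℝ) : EReal) - (φ x + ψ y)

/-- `∫ E dγ` in `[0, ∞]`. -/
def gapIntegral {d : ℕ} (φ ψ : Rd d → EReal) (γ : Measure (Rd d × Rd d)) : ℝ≥0∞ :=
  ∫⁻ p, (dualityGap φ ψ p.1 p.2).toENNReal ∂γ

/-- `∫ (ln dμ/dν)⁺ dμ`. -/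
def entropyPos {X : Type*} [MeasurableSpace X] (μ ν : Measure X) : ℝ≥0∞ :=
  ∫⁻ x, ENNReal.ofReal (Real.log (μ.rnDeriv ν x).toReal) ∂μ

/-- `∫ (ln dμ/dν)⁻ dμ`. -/
def entropyNeg {X : Type*} [MeasurableSpace X] (μ ν : Measure X) : ℝ≥0∞ :=
  ∫⁻ x, ENNReal.ofReal (-Real.log (μ.rnDeriv ν x).toReal) ∂μ

open Classical in
/-- The relative entropy `H(μ | ν) = ∫ ln (dμ/dν) dμ` in `[-∞, ∞]`, which is `+∞` if `μ` is not
absolutely continuous. It is `+∞` as soon as the positive part has infinite integral (this is the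
usual value if the negative part is integrable, and a convention otherwise). -/
def relEntropy {X : Type*} [MeasurableSpace X] (μ ν : Measure X) : EReal :=
  if μ ≪ ν ∧ entropyPos μ ν ≠ ⊤ then (entropyPos μ ν : EReal) - (entropyNeg μ ν : EReal) else ⊤

/-- The differential entropy `H(μ)`, relative to Lebesgue measure. -/
def diffEntropy {X : Type*} [MeasureSpace X] (μ : Measure X) : EReal :=
  relEntropy μ volume

/-- The entropy power `N_k(μ) = exp(-(2/k) H(μ)) / (2πe)` in `[0, ∞]`. -/
def entropyPower {X : Type*} [MeasureSpace X] (k : ℕ) (μ : Measure X) : ℝ≥0∞ :=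
  ENNReal.ofReal (1 / (2 * Real.pi * Real.exp 1)) *
    EReal.exp (((-(2 / (k : ℝ)) : ℝ) : EReal) * diffEntropy μ)

/-- Minty's coordinates `(u, v) = (x + y, x - y) / √2`. -/
def minty {d : ℕ} (p : Rd d × Rd d) : Rd d × Rd d :=
  ((Real.sqrt 2)⁻¹ • (p.1 + p.2), (Real.sqrt 2)⁻¹ • (p.1 - p.2))

/-- The first marginal of the push-forward of `γ` by Minty's change of coordinates. -/
def mintyMarginal {d : ℕ} (γ : Measure (Rd d × Rd d)) : Measure (Rd d) :=
  (γ.map minty).fst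

/-- The standard deviation of `X + Y` for `(X, Y)` of law `γ`, in `[0, ∞]`; it is `∞` if `X + Y` is
not square integrable. -/
def sigmaSum {d : ℕ} (γ : Measure (Rd d × Rd d)) : ℝ≥0∞ :=
  (∫⁻ p, ‖(p.1 + p.2) - ∫ q, (q.1 + q.2) ∂γ‖ₑ ^ 2 ∂γ) ^ (1 / 2 : ℝ)

/-- The constant `C_d = -(d/2) ln (4πe/d)`. -/
def constC (d : ℕ) : ℝ := -((d : ℝ) / 2) * Real.log (4 * Real.pi * Real.exp 1 / d)

end QuadraticOT

end

/-!
In Minty's coordinates `u = (x + y) / √2`, `v = (x - y) / √2` one has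
`‖v - v'‖² = ‖u - u'‖² - 2 ⟪x - x', y - y'⟫`, so a monotone set is the graph of a 1-Lipschitz map
`u ↦ v`. On all of `ℝ^{2d}` the inequality `φ + ψ ≤ c` gives
`-⟪x - x', y - y'⟫ ≤ E(x, y) + E(x', y')`, and Kirszbraun's extension theorem survives such additive
errors: there is a 1-Lipschitz `T` with `‖v - T u‖² / 2 ≤ E(x, y)` everywhere. Similarly the support
of `γ₀` is monotone, because exchanging the targets of two independent pairs of law `γ₀` cannot
lower the optimal cost; for the map `T` of which it is the graph, `‖v - T u‖² / 2` is at most the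
squared distance from `(x, y)` to any point of the support.

In both cases `m = ∫ ‖v - T u‖² / 2 dγ` is bounded by the quantity in the theorem. The shear
`(x, y) ↦ (u, v - T u)` preserves Lebesgue measure, so the product of the density of `μ̂` at `u` and
of the Gaussian density of second moment `2m` at `v - T u` is a probability density, and Gibbs'
inequality against it is the entropy bound. The same Gaussian comparison for `μ̂` itself bounds
`H(μ̂)` from below in terms of the variance of `X + Y`, whence the entropy power bounds.
-/

noncomputable section

namespace QuadraticOT

section Kirszbraun

variable {E F : Type*} [NormedAddCommGroup E] [NormedAddCommGroup F]

/-- A relation between points `u` and `v`, recorded as triples `(u, v, e)`, that is the graph of a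
nonexpansive map up to errors: the squared distances of the values exceed those of the arguments by
at most the sum of the two slacks `e`. -/
def IsNonexpansiveUpTo (M : Set (E × F × ℝ)) : Prop :=
  ∀ p ∈ M, ∀ q ∈ M, ‖p.2.1 - q.2.1‖ ^ 2 ≤ ‖p.1 - q.1‖ ^ 2 + p.2.2 + q.2.2

lemma IsNonexpansiveUpTo.insert_of_norm_sub_sq_le {M : Set (E × F × ℝ)}
    (hM : IsNonexpansiveUpTo M) {u : E} {v : F}
    (hv : ∀ p ∈ M, ‖v - p.2.1‖ ^ 2 ≤ ‖u - p.1‖ ^ 2 + p.2.2) :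
    IsNonexpansiveUpTo (insert (u, v, 0) M) := by
  rintro p (rfl | hp) q (rfl | hq)
  · simp
  · simpa using hv q hq
  · simpa [norm_sub_rev] using hv p hp
  · exact hM p hp q hq

variable [InnerProductSpace ℝ E] [InnerProductSpace ℝ F]

lemma sum_mul_sum_mul_add {ι : Type*} [Fintype ι] {w : ι → ℝ} (hw : ∑ i, w i = 1) (e : ι → ℝ) :
    ∑ i, ∑ j, w i * w j * (e i + e j) = 2 * ∑ i, w i * e i := by
  have h : ∀ i, ∑ j, w i * w j * (e i + e j) = w i * e i + w i * ∑ j, w j * e j := fun i => by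
    rw [Finset.mul_sum, ← mul_one (w i * e i), ← hw, Finset.mul_sum, ← Finset.sum_add_distrib]
    exact Finset.sum_congr rfl fun j _ => by ring
  simp only [h, Finset.sum_add_distrib, ← Finset.sum_mul, hw]
  ring

lemma sum_mul_sum_mul_norm_sub_sq {ι : Type*} [Fintype ι] {w : ι → ℝ} (hw : ∑ i, w i = 1)
    (a : ι → E) (c : E) :
    ∑ i, ∑ j, w i * w j * ‖a i - a j‖ ^ 2 =
      2 * (∑ i, w i * ‖a i - c‖ ^ 2 - ‖∑ i, w i • a i - c‖ ^ 2) := by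
  have hbar : ∑ i, w i • a i - c = ∑ i, w i • (a i - c) := by
    simp only [smul_sub, Finset.sum_sub_distrib, ← Finset.sum_smul, hw, one_smul]
  have hinner : ‖∑ i, w i • a i - c‖ ^ 2 = ∑ i, ∑ j, w i * w j * inner ℝ (a i - c) (a j - c) := by
    rw [hbar, ← real_inner_self_eq_norm_sq]
    simp only [sum_inner, inner_sum, real_inner_smul_left, real_inner_smul_right, mul_assoc]
    exact Finset.sum_congr rfl fun i _ => Finset.sum_congr rfl fun j _ => by
      rw [real_inner_comm]
  rw [hinner, mul_sub, ← sum_mul_sum_mul_add hw, Finset.mul_sum, ← Finset.sum_sub_distrib]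
  refine Finset.sum_congr rfl fun i _ => ?_
  rw [Finset.mul_sum, ← Finset.sum_sub_distrib]
  refine Finset.sum_congr rfl fun j _ => ?_
  rw [← sub_sub_sub_cancel_right (a i) (a j) c, norm_sub_sq_real]
  ring

lemma sum_mul_norm_barycenter_sub_sq_le {ι : Type*} [Fintype ι] {u : ι → E} {v : ι → F}
    {e : ι → ℝ} (h : ∀ i j, ‖v i - v j‖ ^ 2 ≤ ‖u i - u j‖ ^ 2 + e i + e j) {w : ι → ℝ}
    (hw : w ∈ stdSimplex ℝ ι) (x : E) :
    ∑ i, w i * ‖∑ j, w j • v j - v i‖ ^ 2 ≤ ∑ i, w i * (‖x - u i‖ ^ 2 + e i) := by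
  have hv := sum_mul_sum_mul_norm_sub_sq hw.2 v (∑ j, w j • v j)
  have hu := sum_mul_sum_mul_norm_sub_sq hw.2 u x
  have hle : ∑ i, ∑ j, w i * w j * ‖v i - v j‖ ^ 2 ≤
      ∑ i, ∑ j, w i * w j * ‖u i - u j‖ ^ 2 + ∑ i, ∑ j, w i * w j * (e i + e j) := by
    simp only [← Finset.sum_add_distrib, ← mul_add, ← add_assoc]
    exact Finset.sum_le_sum fun i _ => Finset.sum_le_sum fun j _ =>
      mul_le_mul_of_nonneg_left (h i j) (mul_nonneg (hw.1 i) (hw.1 j))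
  rw [hv, hu, sum_mul_sum_mul_add hw.2, sub_self, norm_zero] at hle
  simp only [norm_sub_rev _ (v _), norm_sub_rev x, mul_add, Finset.sum_add_distrib]
  linarith [sq_nonneg ‖∑ i, w i • u i - x‖]

lemma convexOn_sum_mul_norm_sub_sq_sub {ι : Type*} [Fintype ι] {K : Set F} (hK : Convex ℝ K)
    {w : ι → ℝ} (hw : ∀ i, 0 ≤ w i) (v : ι → F) (c : ι → ℝ) :
    ConvexOn ℝ K fun y => ∑ i, w i * (‖y - v i‖ ^ 2 - c i) := by
  have hterm : ∀ i, ConvexOn ℝ K fun y => w i * (‖y - v i‖ ^ 2 - c i) := fun i => by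
    simp only [← dist_eq_norm]
    exact (((convexOn_dist (v i) hK).pow (fun _ _ => dist_nonneg) 2).add_const (-c i)).smul (hw i)
  simpa only [Finset.sum_fn] using Finset.sum_induction _ (ConvexOn ℝ K)
    (fun _ _ => ConvexOn.add) (convexOn_const 0 hK) fun i _ => hterm i

-- The minimax theorem trades the common point for weights, against which the barycenter wins.
lemma exists_forall_norm_sub_sq_le {ι : Type*} [Finite ι] {u : ι → E} {v : ι → F} {e : ι → ℝ}
    (h : ∀ i j, ‖v i - v j‖ ^ 2 ≤ ‖u i - u j‖ ^ 2 + e i + e j) (x : E) :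
    ∃ y, ∀ i, ‖y - v i‖ ^ 2 ≤ ‖x - u i‖ ^ 2 + e i := by
  classical
  cases nonempty_fintype ι
  rcases isEmpty_or_nonempty ι with _ | _
  · exact ⟨0, isEmptyElim⟩
  by_contra! hcon
  set f : F → (ι → ℝ) → ℝ := fun y w => ∑ i, w i * (‖y - v i‖ ^ 2 - (‖x - u i‖ ^ 2 + e i))
  have hconv : ∀ w ∈ stdSimplex ℝ ι, ConvexOn ℝ (convexHull ℝ (Set.range v)) (f · w) :=
    fun w hw => convexOn_sum_mul_norm_sub_sq_sub (convex_convexHull ℝ _) hw.1 v _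
  have hconc : ∀ y, ConcaveOn ℝ (stdSimplex ℝ ι) (f y) := fun y =>
    (Fintype.linearCombination ℝ fun i => ‖y - v i‖ ^ 2 - (‖x - u i‖ ^ 2 + e i)).concaveOn
      (convex_stdSimplex ℝ ι)
  obtain ⟨w, hw, hpos⟩ := Sion.exists_lt_iInf_of_lt_iInf_of_finite (f := f) (t := 0)
    (Set.range_nonempty v).convexHull
    ((Set.finite_range v).isCompact_convexHull ℝ)
    (fun w _ => (Continuous.lowerSemicontinuous (by fun_prop)).lowerSemicontinuousOn _)
    (fun w hw => (hconv w hw).quasiconvexOn)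
    (convex_stdSimplex ℝ ι)
    (fun y _ => (Continuous.upperSemicontinuous (by fun_prop)).upperSemicontinuousOn _)
    (fun y _ => (hconc y).quasiconcaveOn)
    (convex_convexHull ℝ _) (Set.finite_range fun i => Pi.single i (1 : ℝ))
    (Set.range_subset_iff.2 fun i => single_mem_stdSimplex ℝ i)
    fun y _ => by
      obtain ⟨i, hi⟩ := hcon y
      exact ⟨Pi.single i 1, Set.mem_range_self i, by simpa [f, Pi.single_apply] using hi⟩
  have hbar := hpos _ ((convex_convexHull ℝ _).sum_mem (fun i _ => hw.1 i) hw.2 fun i _ =>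
    subset_convexHull ℝ _ (Set.mem_range_self i))
  have hle := sum_mul_norm_barycenter_sub_sq_le h hw x
  simp only [f, mul_sub, Finset.sum_sub_distrib] at hbar
  linarith

lemma IsNonexpansiveUpTo.exists_norm_sub_sq_le [ProperSpace F] {M : Set (E × F × ℝ)}
    (hM : IsNonexpansiveUpTo M) (u : E) :
    ∃ v : F, ∀ p ∈ M, ‖v - p.2.1‖ ^ 2 ≤ ‖u - p.1‖ ^ 2 + p.2.2 := by
  classical
  rcases M.eq_empty_or_nonempty with rfl | ⟨p₀, hp₀⟩
  · exact ⟨0, by simp⟩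
  set B : M → Set F := fun p => {v | ‖v - p.1.2.1‖ ^ 2 ≤ ‖u - p.1.1‖ ^ 2 + p.1.2.2}
  have hclosed : ∀ p, IsClosed (B p) := fun p => isClosed_le (by fun_prop) continuous_const
  have hcompact : IsCompact (B ⟨p₀, hp₀⟩) :=
    Metric.isCompact_of_isClosed_isBounded (hclosed _) <|
      (Metric.isBounded_closedBall (x := p₀.2.1)).subset fun v hv =>
        mem_closedBall_iff_norm.2 (Real.le_sqrt_of_sq_le hv)
  obtain ⟨v, -, hv⟩ := hcompact.inter_iInter_nonempty B hclosed fun S => by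
    obtain ⟨v, hv⟩ := exists_forall_norm_sub_sq_le
      (fun i j : (insert ⟨p₀, hp₀⟩ S : Finset M) => hM _ i.1.2 _ j.1.2) u
    exact ⟨v, hv ⟨_, Finset.mem_insert_self _ _⟩,
      Set.mem_iInter₂.2 fun p hp => hv ⟨p, Finset.mem_insert_of_mem hp⟩⟩
  exact ⟨v, fun p hp => Set.mem_iInter.1 hv ⟨p, hp⟩⟩

/-- Kirszbraun's theorem with slacks. In a maximal extension of `M` every point of `E` carries a
triple with slack `0`, hence the single slack in the bound. -/
theorem IsNonexpansiveUpTo.exists_lipschitzWith [ProperSpace F] {M : Set (E × F × ℝ)}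
    (hM : IsNonexpansiveUpTo M) :
    ∃ T : E → F, LipschitzWith 1 T ∧ ∀ p ∈ M, ‖T p.1 - p.2.1‖ ^ 2 ≤ p.2.2 := by
  obtain ⟨N, hMN, hN⟩ := zorn_subset_nonempty {N : Set (E × F × ℝ) | IsNonexpansiveUpTo N}
    (fun c hc hchain _ => ⟨⋃₀ c, fun p ⟨A, hA, hp⟩ q ⟨B, hB, hq⟩ => by
      rcases hchain.total hA hB with h | h
      · exact hc hB p (h hp) q hq
      · exact hc hA p hp q (h hq), fun _ => Set.subset_sUnion_of_mem⟩) M hM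
  have htotal : ∀ u, ∃ v, (u, v, 0) ∈ N := fun u => by
    obtain ⟨v, hv⟩ := hN.prop.exists_norm_sub_sq_le u
    exact ⟨v, hN.le_of_ge (hN.prop.insert_of_norm_sub_sq_le hv) (Set.subset_insert _ _)
      (Set.mem_insert _ _)⟩
  choose T hT using htotal
  refine ⟨T, LipschitzWith.of_dist_le_mul fun u w => ?_, fun p hp => ?_⟩
  · simpa [dist_eq_norm, sq_le_sq₀] using hN.prop _ (hT u) _ (hT w)
  · simpa using hN.prop _ (hT p.1) _ (hMN hp)

end Kirszbraun

section Minty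

variable {d : ℕ}

lemma norm_inv_sqrt_two_smul_sq {V : Type*} [SeminormedAddCommGroup V] [NormedSpace ℝ V] (x : V) :
    ‖(Real.sqrt 2)⁻¹ • x‖ ^ 2 = ‖x‖ ^ 2 / 2 := by
  rw [norm_smul, mul_pow, Real.norm_eq_abs, sq_abs, inv_pow, Real.sq_sqrt (by norm_num)]
  ring

lemma norm_minty_fst_sq (p : Rd d × Rd d) : ‖(minty p).1‖ ^ 2 = ‖p.1 + p.2‖ ^ 2 / 2 :=
  norm_inv_sqrt_two_smul_sq _

lemma norm_minty_snd_sq (p : Rd d × Rd d) : ‖(minty p).2‖ ^ 2 = ‖p.1 - p.2‖ ^ 2 / 2 :=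
  norm_inv_sqrt_two_smul_sq _

lemma norm_minty_fst_sq_add_norm_minty_snd_sq (p : Rd d × Rd d) :
    ‖(minty p).1‖ ^ 2 + ‖(minty p).2‖ ^ 2 = ‖p.1‖ ^ 2 + ‖p.2‖ ^ 2 := by
  rw [norm_minty_fst_sq, norm_minty_snd_sq, norm_add_sq_real, norm_sub_sq_real]
  ring

lemma isLinearMap_minty : IsLinearMap ℝ (minty (d := d)) where
  map_add p q := by
    ext1 <;> simp only [minty, Prod.fst_add, Prod.snd_add, ← smul_add] <;> congr 1 <;> abel
  map_smul c p := by
    ext1 <;> simp only [minty, Prod.smul_fst, Prod.smul_snd, ← smul_add, ← smul_sub] <;>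
      rw [smul_comm]

lemma norm_minty_snd_sub_sq (p q : Rd d × Rd d) :
    ‖(minty p).2 - (minty q).2‖ ^ 2 =
      ‖(minty p).1 - (minty q).1‖ ^ 2 - 2 * inner ℝ (p.1 - q.1) (p.2 - q.2) := by
  rw [← Prod.fst_sub, ← Prod.snd_sub, ← isLinearMap_minty.map_sub, norm_minty_fst_sq,
    norm_minty_snd_sq, norm_add_sq_real, norm_sub_sq_real, Prod.fst_sub, Prod.snd_sub]
  ring

lemma continuous_minty : Continuous (minty (d := d)) := by
  unfold minty; fun_prop

/-- Minty's coordinates of `p`, the second one measured from the graph of `T`. -/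
def mintyShear (T : Rd d → Rd d) (p : Rd d × Rd d) : Rd d × Rd d :=
  ((minty p).1, (minty p).2 - T (minty p).1)

lemma measurePreserving_minty : MeasurePreserving (minty (d := d)) volume volume := by
  let e := WithLp.linearEquiv 2 ℝ (Rd d × Rd d)
  let L : WithLp 2 (Rd d × Rd d) →ₗᵢ[ℝ] WithLp 2 (Rd d × Rd d) :=
    { toLinearMap := e.symm.toLinearMap ∘ₗ isLinearMap_minty.mk' minty ∘ₗ e.toLinearMap
      norm_map' := fun z => by
        refine (sq_eq_sq₀ (norm_nonneg _) (norm_nonneg _)).1 ?_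
        rw [WithLp.prod_norm_sq_eq_of_L2, WithLp.prod_norm_sq_eq_of_L2]
        exact norm_minty_fst_sq_add_norm_minty_snd_sq z.ofLp }
  exact ((WithLp.volume_preserving_ofLp (Rd d) (Rd d)).comp
    (L.toLinearIsometryEquiv rfl).measurePreserving).comp
      (WithLp.volume_preserving_toLp (Rd d) (Rd d))

lemma measurePreserving_mintyShear {T : Rd d → Rd d} (hT : Measurable T) :
    MeasurePreserving (mintyShear T) volume volume := by
  refine MeasurePreserving.comp (g := fun q : Rd d × Rd d => (q.1, q.2 - T q.1)) ?_
    measurePreserving_minty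
  refine (MeasurePreserving.id volume).skew_product (g := fun u v => v - T u) (by fun_prop) ?_
  exact ae_of_all _ fun u => (measurePreserving_sub_right volume (T u)).map_eq

end Minty

section Graphs

variable {d : ℕ} {φ ψ : Rd d → EReal} {x y x' y' : Rd d}

lemma quadCost_exchange (x y x' y' : Rd d) :
    quadCost x y' + quadCost x' y = quadCost x y + quadCost x' y' + inner ℝ (x - x') (y - y') := by
  simp only [quadCost, norm_sub_sq_real, inner_sub_left, inner_sub_right]
  ring

lemma exists_eq_coe_of_dualityGap_ne_top (h : φ x + ψ y ≤ (quadCost x y : EReal))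
    (hgap : dualityGap φ ψ x y ≠ ⊤) : ∃ r s : ℝ, φ x = r ∧ ψ y = s := by
  have hbot : φ x + ψ y ≠ ⊥ := fun hb => hgap (by rw [dualityGap, hb, EReal.coe_sub_bot])
  have : φ x + ψ y ≠ ⊤ := ne_top_of_le_ne_top (EReal.coe_ne_top _) h
  induction hφ : φ x <;> induction hψ : ψ y <;> simp_all

lemma dualityGap_coe {r s : ℝ} (hr : φ x = r) (hs : ψ y = s) :
    dualityGap φ ψ x y = ((quadCost x y - (r + s) : ℝ) : EReal) := by
  rw [dualityGap, hr, hs]; norm_cast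

lemma neg_inner_le_dualityGap_add_dualityGap (h : ∀ x y, φ x + ψ y ≤ (quadCost x y : EReal))
    (hxy : dualityGap φ ψ x y ≠ ⊤) (hxy' : dualityGap φ ψ x' y' ≠ ⊤) :
    -inner ℝ (x - x') (y - y') ≤
      (dualityGap φ ψ x y).toReal + (dualityGap φ ψ x' y').toReal := by
  obtain ⟨r, s, hr, hs⟩ := exists_eq_coe_of_dualityGap_ne_top (h x y) hxy
  obtain ⟨r', s', hr', hs'⟩ := exists_eq_coe_of_dualityGap_ne_top (h x' y') hxy'
  have hle : r + s' ≤ quadCost x y' := by have := h x y'; rw [hr, hs'] at this; exact_mod_cast this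
  have hle' : r' + s ≤ quadCost x' y := by
    have := h x' y; rw [hr', hs] at this; exact_mod_cast this
  rw [dualityGap_coe hr hs, dualityGap_coe hr' hs', EReal.toReal_coe, EReal.toReal_coe]
  linarith [quadCost_exchange x y x' y']

theorem exists_lipschitzWith_le_dualityGap (h : ∀ x y, φ x + ψ y ≤ (quadCost x y : EReal)) :
    ∃ T : Rd d → Rd d, LipschitzWith 1 T ∧ ∀ p : Rd d × Rd d,
      ENNReal.ofReal (‖(mintyShear T p).2‖ ^ 2 / 2) ≤ (dualityGap φ ψ p.1 p.2).toENNReal := by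
  have hM : IsNonexpansiveUpTo
      ((fun p : Rd d × Rd d => ((minty p).1, (minty p).2, 2 * (dualityGap φ ψ p.1 p.2).toReal)) ''
        {p | dualityGap φ ψ p.1 p.2 ≠ ⊤}) := by
    rintro _ ⟨p, hp, rfl⟩ _ ⟨q, hq, rfl⟩
    rw [norm_minty_snd_sub_sq]
    linarith [neg_inner_le_dualityGap_add_dualityGap h hp hq]
  obtain ⟨T, hT, hTM⟩ := hM.exists_lipschitzWith
  refine ⟨T, hT, fun p => ?_⟩
  by_cases hp : dualityGap φ ψ p.1 p.2 = ⊤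
  · rw [hp, EReal.toENNReal_top]; exact le_top
  rw [EReal.toENNReal_of_ne_top hp]
  refine ENNReal.ofReal_le_ofReal ?_
  have := hTM _ ⟨p, hp, rfl⟩
  rw [mintyShear, norm_sub_rev]
  linarith

/-- Monotone subsets of `V × V`, that is, graphs of monotone set-valued maps. -/
def IsMonotoneSet {V : Type*} [NormedAddCommGroup V] [InnerProductSpace ℝ V] (Γ : Set (V × V)) :
    Prop :=
  ∀ p ∈ Γ, ∀ q ∈ Γ, 0 ≤ inner ℝ (p.1 - q.1) (p.2 - q.2)

theorem IsMonotoneSet.exists_lipschitzWith {Γ : Set (Rd d × Rd d)} (hΓ : IsMonotoneSet Γ) :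
    ∃ T : Rd d → Rd d, LipschitzWith 1 T ∧ ∀ p ∈ Γ, T (minty p).1 = (minty p).2 := by
  have hM : IsNonexpansiveUpTo
      ((fun p : Rd d × Rd d => ((minty p).1, (minty p).2, (0 : ℝ))) '' Γ) := by
    rintro _ ⟨p, hp, rfl⟩ _ ⟨q, hq, rfl⟩
    rw [norm_minty_snd_sub_sq]
    linarith [hΓ p hp q hq]
  obtain ⟨T, hT, hTM⟩ := hM.exists_lipschitzWith
  exact ⟨T, hT, fun p hp => by simpa [sub_eq_zero] using hTM _ ⟨p, hp, rfl⟩⟩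

lemma norm_mintyShear_snd_sq_div_two_le {T : Rd d → Rd d} (hT : LipschitzWith 1 T)
    {q : Rd d × Rd d} (hq : T (minty q).1 = (minty q).2) (p : Rd d × Rd d) :
    ‖(mintyShear T p).2‖ ^ 2 / 2 ≤ sqDist2d p q := by
  have hlip : ‖T (minty q).1 - T (minty p).1‖ ≤ ‖(minty (p - q)).1‖ := by
    rw [isLinearMap_minty.map_sub, Prod.fst_sub, norm_sub_rev]
    simpa only [dist_eq_norm, NNReal.coe_one, one_mul] using hT.dist_le_mul _ _
  have htri : ‖(mintyShear T p).2‖ ≤ ‖(minty (p - q)).2‖ + ‖(minty (p - q)).1‖ := by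
    refine (norm_sub_le_norm_sub_add_norm_sub _ (T (minty q).1) _).trans (add_le_add ?_ hlip)
    rw [hq, isLinearMap_minty.map_sub, Prod.snd_sub]
  have hdist : ‖(minty (p - q)).1‖ ^ 2 + ‖(minty (p - q)).2‖ ^ 2 = sqDist2d p q :=
    norm_minty_fst_sq_add_norm_minty_snd_sq (p - q)
  have hsq := pow_le_pow_left₀ (norm_nonneg _) htri 2
  linarith [add_sq_le (a := ‖(minty (p - q)).2‖) (b := ‖(minty (p - q)).1‖)]

theorem lintegral_norm_mintyShear_snd_sq_le_W2sq {T : Rd d → Rd d} (hT : LipschitzWith 1 T)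
    {γ₀ : Measure (Rd d × Rd d)} (h : ∀ᵐ p ∂γ₀, T (minty p).1 = (minty p).2)
    (γ : Measure (Rd d × Rd d)) :
    ∫⁻ p, ENNReal.ofReal (‖(mintyShear T p).2‖ ^ 2 / 2) ∂γ ≤ W2sq γ γ₀ := by
  refine le_iInf₂ fun π hπ => ?_
  have hmeas := (measurePreserving_mintyShear hT.continuous.measurable).measurable
  rw [← hπ.1, Measure.fst, lintegral_map
    ((hmeas.snd.norm.pow_const 2).div_const 2).ennreal_ofReal measurable_fst]
  rw [← hπ.2] at h
  refine lintegral_mono_ae ?_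
  filter_upwards [ae_of_ae_map measurable_snd.aemeasurable h] with q hq
  exact ENNReal.ofReal_le_ofReal (norm_mintyShear_snd_sq_div_two_le hT hq q.1)

end Graphs

section Exchange

variable {X Y : Type*} {c : X × Y → ℝ≥0∞}

/-- The pairs of pairs whose targets are better exchanged, for the cost `c`. -/
def exchangeSet (c : X × Y → ℝ≥0∞) : Set ((X × Y) × (X × Y)) :=
  {q | c (q.1.1, q.2.2) + c (q.2.1, q.1.2) < c q.1 + c q.2}

open Classical in
/-- Exchange the targets of two pairs when this lowers the cost. -/
def exchange (c : X × Y → ℝ≥0∞) (q : (X × Y) × (X × Y)) : (X × Y) × (X × Y) :=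
  if q ∈ exchangeSet c then ((q.1.1, q.2.2), (q.2.1, q.1.2)) else q

lemma isOpen_exchangeSet [TopologicalSpace X] [TopologicalSpace Y] (hc : Continuous c) :
    IsOpen (exchangeSet c) :=
  isOpen_lt (f := fun q : (X × Y) × (X × Y) => c (q.1.1, q.2.2) + c (q.2.1, q.1.2))
    (g := fun q => c q.1 + c q.2) (by fun_prop) (by fun_prop)

lemma exchange_add_le (q : (X × Y) × (X × Y)) :
    c (exchange c q).1 + c (exchange c q).2 ≤ c q.1 + c q.2 := by
  unfold exchange
  split_ifs with hq
  exacts [hq.le, le_rfl]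

lemma apply_fst_exchange_add (f : X → ℝ≥0∞) (q : (X × Y) × (X × Y)) :
    f (exchange c q).1.1 + f (exchange c q).2.1 = f q.1.1 + f q.2.1 := by
  unfold exchange
  split_ifs <;> rfl

lemma apply_snd_exchange_add (f : Y → ℝ≥0∞) (q : (X × Y) × (X × Y)) :
    f (exchange c q).1.2 + f (exchange c q).2.2 = f q.1.2 + f q.2.2 := by
  unfold exchange
  split_ifs
  exacts [add_comm _ _, rfl]

variable [MeasurableSpace X] [MeasurableSpace Y] {γ : Measure (X × Y)}

lemma measurableSet_exchangeSet (hc : Measurable c) : MeasurableSet (exchangeSet c) :=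
  measurableSet_lt
    (f := fun q : (X × Y) × (X × Y) => c (q.1.1, q.2.2) + c (q.2.1, q.1.2))
    (g := fun q => c q.1 + c q.2) (by fun_prop) (by fun_prop)

lemma measurable_exchange (hc : Measurable c) : Measurable (exchange c) :=
  Measurable.ite (measurableSet_exchangeSet hc) (by fun_prop) measurable_id

/-- The law of a pair drawn at random from two independent pairs of law `γ`, after their targets
have been exchanged where this lowers the cost. -/
def exchangePlan (c : X × Y → ℝ≥0∞) (γ : Measure (X × Y)) : Measure (X × Y) :=
  (2⁻¹ : ℝ≥0∞) • ((((γ.prod γ).map (exchange c)).fst + ((γ.prod γ).map (exchange c)).snd))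

lemma lintegral_exchangePlan (hc : Measurable c) {f : X × Y → ℝ≥0∞} (hf : Measurable f) :
    ∫⁻ p, f p ∂exchangePlan c γ =
      2⁻¹ * ∫⁻ q, f (exchange c q).1 + f (exchange c q).2 ∂γ.prod γ := by
  have he := measurable_exchange hc
  rw [exchangePlan, lintegral_smul_measure, lintegral_add_measure, Measure.fst, Measure.snd,
    lintegral_map hf measurable_fst, lintegral_map hf measurable_snd,
    lintegral_map (by fun_prop) he, lintegral_map (by fun_prop) he,
    ← lintegral_add_left (by fun_prop), smul_eq_mul]

lemma inv_two_mul_lintegral_prod_add [IsProbabilityMeasure γ] {f : X × Y → ℝ≥0∞}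
    (hf : Measurable f) : 2⁻¹ * ∫⁻ q, f q.1 + f q.2 ∂γ.prod γ = ∫⁻ p, f p ∂γ := by
  rw [lintegral_add_left (by fun_prop), measurePreserving_fst.lintegral_comp hf,
    measurePreserving_snd.lintegral_comp hf, ← two_mul, ← mul_assoc,
    ENNReal.inv_mul_cancel two_ne_zero ENNReal.ofNat_ne_top, one_mul]

lemma isPlan_exchangePlan [IsProbabilityMeasure γ] (hc : Measurable c) :
    IsPlan γ.fst γ.snd (exchangePlan c γ) := by
  constructor
  · refine Measure.ext_of_lintegral _ fun f hf => ?_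
    rw [Measure.fst, Measure.fst, lintegral_map hf measurable_fst, lintegral_map hf measurable_fst,
      lintegral_exchangePlan hc (f := fun p => f p.1) (by fun_prop)]
    simp only [apply_fst_exchange_add]
    exact inv_two_mul_lintegral_prod_add (f := fun p => f p.1) (by fun_prop)
  · refine Measure.ext_of_lintegral _ fun f hf => ?_
    rw [Measure.snd, Measure.snd, lintegral_map hf measurable_snd, lintegral_map hf measurable_snd,
      lintegral_exchangePlan hc (f := fun p => f p.2) (by fun_prop)]
    simp only [apply_snd_exchange_add]
    exact inv_two_mul_lintegral_prod_add (f := fun p => f p.2) (by fun_prop)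

theorem prod_exchangeSet_eq_zero [IsProbabilityMeasure γ] (hc : Measurable c)
    (hfin : ∫⁻ p, c p ∂γ ≠ ⊤) (hopt : ∫⁻ p, c p ∂γ ≤ ∫⁻ p, c p ∂exchangePlan c γ) :
    γ.prod γ (exchangeSet c) = 0 := by
  have he := measurable_exchange hc
  have hle : ∫⁻ q, c q.1 + c q.2 ∂γ.prod γ ≤
      ∫⁻ q, c (exchange c q).1 + c (exchange c q).2 ∂γ.prod γ := by
    rw [← inv_two_mul_lintegral_prod_add hc, lintegral_exchangePlan hc hc] at hopt
    exact (ENNReal.mul_le_mul_iff_right (by simp) (by simp)).1 hopt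
  have hfin' : ∫⁻ q, c q.1 + c q.2 ∂γ.prod γ ≠ ⊤ := by
    rw [← inv_two_mul_lintegral_prod_add hc] at hfin
    exact fun h => hfin (by rw [h, ENNReal.mul_top (by simp)])
  have heq := ae_eq_of_ae_le_of_lintegral_le (ae_of_all _ exchange_add_le)
    (ne_top_of_le_ne_top hfin' (lintegral_mono exchange_add_le)) (by fun_prop) hle
  refine measure_mono_null (fun q hq => ?_) heq
  simpa only [Set.mem_compl_iff, Set.mem_ofPred_eq, exchange, if_pos hq] using hq.ne

end Exchange

section MonotoneSupport

variable {d : ℕ} {μ₀ μ₁ : Measure (Rd d)} {γ : Measure (Rd d × Rd d)}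

lemma quadCost_nonneg (x y : Rd d) : 0 ≤ quadCost x y := by
  unfold quadCost; positivity

lemma continuous_ofReal_quadCost :
    Continuous fun p : Rd d × Rd d => ENNReal.ofReal (quadCost p.1 p.2) := by
  unfold quadCost
  exact ENNReal.continuous_ofReal.comp (by fun_prop)

lemma lintegral_quadCost_ne_top (h₁ : MemLp Prod.fst 2 γ) (h₂ : MemLp Prod.snd 2 γ) :
    ∫⁻ p, ENNReal.ofReal (quadCost p.1 p.2) ∂γ ≠ ⊤ :=
  (((h₁.sub h₂).integrable_norm_pow two_ne_zero).div_const 2).lintegral_lt_top.ne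

lemma mem_exchangeSet_quadCost {p q : Rd d × Rd d} :
    (p, q) ∈ exchangeSet (fun p : Rd d × Rd d => ENNReal.ofReal (quadCost p.1 p.2)) ↔
      inner ℝ (p.1 - q.1) (p.2 - q.2) < 0 := by
  have h := quadCost_nonneg (d := d)
  simp only [exchangeSet, Set.mem_ofPred_eq]
  rw [← ENNReal.ofReal_add (h _ _) (h _ _), ← ENNReal.ofReal_add (h _ _) (h _ _),
    ENNReal.ofReal_lt_ofReal_iff_of_nonneg (add_nonneg (h _ _) (h _ _)), quadCost_exchange,
    add_lt_iff_neg_left]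

lemma isMonotoneSet_support [SFinite γ]
    (h : γ.prod γ (exchangeSet fun p : Rd d × Rd d => ENNReal.ofReal (quadCost p.1 p.2)) = 0) :
    IsMonotoneSet γ.support := by
  intro p hp q hq
  by_contra! hneg
  have hopen := isOpen_exchangeSet (continuous_ofReal_quadCost (d := d))
  obtain ⟨U, hU, V, hV, hUV⟩ := mem_nhds_prod_iff.1
    (hopen.mem_nhds (mem_exchangeSet_quadCost.2 hneg))
  have hnull := measure_mono_null hUV h
  rw [Measure.prod_prod, mul_eq_zero] at hnull
  rcases hnull with hnull | hnull
  · exact ((Measure.mem_support_iff_forall p).1 hp U hU).ne' hnull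
  · exact ((Measure.mem_support_iff_forall q).1 hq V hV).ne' hnull

theorem IsOptimalPlan.isMonotoneSet_support (hμ₀ : IsP2 μ₀) (hμ₁ : IsP2 μ₁)
    (hγ : IsOptimalPlan μ₀ μ₁ γ) : IsMonotoneSet γ.support := by
  obtain ⟨⟨rfl, rfl⟩, hopt⟩ := hγ
  have := hμ₀.1
  rw [Measure.fst] at this
  have : IsProbabilityMeasure γ := Measure.isProbabilityMeasure_of_map Prod.fst
  have hc := continuous_ofReal_quadCost (d := d).measurable
  exact QuadraticOT.isMonotoneSet_support <| prod_exchangeSet_eq_zero hc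
    (lintegral_quadCost_ne_top (hμ₀.2.comp_measurePreserving ⟨measurable_fst, rfl⟩)
      (hμ₁.2.comp_measurePreserving ⟨measurable_snd, rfl⟩))
    (hopt _ (isPlan_exchangePlan hc))

end MonotoneSupport

section Entropy

variable {X : Type*} [MeasurableSpace X] {μ : Measure X} {f h k : X → ℝ}

open Classical in
/-- The integral of a real function in `[-∞, ∞]`, with the convention of `relEntropy`: it is `+∞` as
soon as the positive part has infinite integral. -/
def extIntegral (μ : Measure X) (f : X → ℝ) : EReal :=
  if ∫⁻ x, ENNReal.ofReal (f x) ∂μ = ⊤ then ⊤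
  else ((∫⁻ x, ENNReal.ofReal (f x) ∂μ : ℝ≥0∞) : EReal)
    - ((∫⁻ x, ENNReal.ofReal (-f x) ∂μ : ℝ≥0∞) : EReal)

lemma extIntegral_eq_top (hpos : ∫⁻ x, ENNReal.ofReal (f x) ∂μ = ⊤) : extIntegral μ f = ⊤ :=
  if_pos hpos

lemma extIntegral_eq_bot (hpos : ∫⁻ x, ENNReal.ofReal (f x) ∂μ ≠ ⊤)
    (hneg : ∫⁻ x, ENNReal.ofReal (-f x) ∂μ = ⊤) : extIntegral μ f = ⊥ := by
  rw [extIntegral, if_neg hpos, hneg, EReal.coe_ennreal_top, EReal.sub_top]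

lemma extIntegral_eq_integral (hf : Integrable f μ) :
    extIntegral μ f = ((∫ x, f x ∂μ : ℝ) : EReal) := by
  have hpos := hf.lintegral_lt_top.ne
  have hneg : ∫⁻ x, ENNReal.ofReal (-f x) ∂μ ≠ ⊤ := hf.neg.lintegral_lt_top.ne
  rw [extIntegral, if_neg hpos, integral_eq_lintegral_pos_part_sub_lintegral_neg_part hf,
    EReal.coe_sub, EReal.coe_ennreal_toReal hpos, EReal.coe_ennreal_toReal hneg]

lemma extIntegral_map {Y : Type*} [MeasurableSpace Y] {Φ : X → Y} (hΦ : Measurable Φ) {g : Y → ℝ}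
    (hg : Measurable g) : extIntegral (μ.map Φ) g = extIntegral μ fun x => g (Φ x) := by
  rw [extIntegral, extIntegral, lintegral_map hg.ennreal_ofReal hΦ,
    lintegral_map (f := fun y => ENNReal.ofReal (-g y)) hg.neg.ennreal_ofReal hΦ]

lemma extIntegral_fst_map {Y Z : Type*} [MeasurableSpace Y] [MeasurableSpace Z] {Φ : X → Y × Z}
    (hΦ : Measurable Φ) {g : Y → ℝ} (hg : Measurable g) :
    extIntegral (μ.map Φ).fst g = extIntegral μ fun x => g (Φ x).1 := by
  rw [Measure.fst, Measure.map_map measurable_fst hΦ]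
  exact extIntegral_map hΦ.fst hg

lemma integrable_of_lintegral_ofReal_ne_top (hf : AEStronglyMeasurable f μ)
    (hpos : ∫⁻ x, ENNReal.ofReal (f x) ∂μ ≠ ⊤) (hneg : ∫⁻ x, ENNReal.ofReal (-f x) ∂μ ≠ ⊤) :
    Integrable f μ := by
  refine ⟨hf, lt_of_le_of_lt ?_ (ENNReal.add_lt_top.2 ⟨hpos.lt_top, hneg.lt_top⟩)⟩
  rw [← lintegral_add_left' hf.aemeasurable.ennreal_ofReal]
  refine lintegral_mono fun x => ?_
  rw [Real.enorm_eq_ofReal_abs]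
  rcases abs_choice (f x) with habs | habs <;> rw [habs]
  exacts [le_self_add, le_add_self]

lemma lintegral_ofReal_ne_top_of_le_add (hh : AEStronglyMeasurable h μ)
    (hpos : ∫⁻ x, ENNReal.ofReal (h x) ∂μ ≠ ⊤) (hk : Integrable k μ)
    (hle : ∀ᵐ x ∂μ, f x ≤ h x + k x) : ∫⁻ x, ENNReal.ofReal (f x) ∂μ ≠ ⊤ := by
  refine ne_top_of_le_ne_top (ENNReal.add_ne_top.2 ⟨hpos, hk.lintegral_lt_top.ne⟩) ?_
  rw [← lintegral_add_left' hh.aemeasurable.ennreal_ofReal]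
  refine lintegral_mono_ae (hle.mono fun x hx => ?_)
  exact (ENNReal.ofReal_le_ofReal hx).trans ENNReal.ofReal_add_le

theorem extIntegral_le_add (hf : AEStronglyMeasurable f μ) (hh : AEStronglyMeasurable h μ)
    (hk : Integrable k μ) (hle : ∀ᵐ x ∂μ, f x ≤ h x + k x) :
    extIntegral μ f ≤ extIntegral μ h + ((∫ x, k x ∂μ : ℝ) : EReal) := by
  by_cases hpos : ∫⁻ x, ENNReal.ofReal (h x) ∂μ = ⊤
  · rw [extIntegral_eq_top hpos, EReal.top_add_coe]
    exact le_top
  have hfpos := lintegral_ofReal_ne_top_of_le_add hh hpos hk hle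
  by_cases hneg : ∫⁻ x, ENNReal.ofReal (-f x) ∂μ = ⊤
  · rw [extIntegral_eq_bot hfpos hneg]
    exact bot_le
  have hhneg : ∫⁻ x, ENNReal.ofReal (-h x) ∂μ ≠ ⊤ :=
    lintegral_ofReal_ne_top_of_le_add hf.neg hneg hk
      (hle.mono fun x hx => by simp only [Pi.neg_apply]; linarith)
  have hfi := integrable_of_lintegral_ofReal_ne_top hf hfpos hneg
  have hhi := integrable_of_lintegral_ofReal_ne_top hh hpos hhneg
  rw [extIntegral_eq_integral hfi, extIntegral_eq_integral hhi, ← EReal.coe_add,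
    EReal.coe_le_coe_iff, ← integral_add hhi hk]
  exact integral_mono_ae hfi (hhi.add hk) hle

variable {γ ν : Measure X}

lemma relEntropy_eq_extIntegral (hγ : γ ≪ ν) : relEntropy γ ν = extIntegral γ (llr γ ν) := by
  by_cases hpos : entropyPos γ ν = ⊤
  · rw [relEntropy, if_neg fun h => h.2 hpos, extIntegral_eq_top (by exact hpos)]
  · rw [relEntropy, if_pos ⟨hγ, hpos⟩, extIntegral, if_neg (by exact hpos)]
    rfl

lemma log_toReal_le_log_toReal_add {a b : ℝ≥0∞} (ha : a ≠ 0) (ha' : a ≠ ⊤) (hb : b ≠ 0)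
    (hb' : b ≠ ⊤) : Real.log a.toReal ≤ Real.log b.toReal + ((a / b).toReal - 1) := by
  have ha₀ := ENNReal.toReal_pos ha ha'
  have hb₀ := ENNReal.toReal_pos hb hb'
  have hlog := Real.log_le_sub_one_of_pos (div_pos ha₀ hb₀)
  rw [Real.log_div ha₀.ne' hb₀.ne'] at hlog
  rw [ENNReal.toReal_div]
  linarith

lemma lintegral_div_rnDeriv_le [SigmaFinite γ] [SigmaFinite ν] (hγ : γ ≪ ν) {Q : X → ℝ≥0∞}
    (hQ : Measurable Q) : ∫⁻ x, Q x / γ.rnDeriv ν x ∂γ ≤ ∫⁻ x, Q x ∂ν := by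
  rw [← lintegral_rnDeriv_mul hγ (by fun_prop)]
  exact lintegral_mono fun x => ENNReal.mul_div_le

theorem extIntegral_log_le_relEntropy [IsProbabilityMeasure γ] [SigmaFinite ν] (hγ : γ ≪ ν)
    {Q : X → ℝ≥0∞} (hQ : Measurable Q) (hQ₀ : ∀ᵐ x ∂γ, Q x ≠ 0) (hQ₁ : ∫⁻ x, Q x ∂ν ≤ 1) :
    extIntegral γ (fun x => Real.log (Q x).toReal) ≤ relEntropy γ ν := by
  have hm : AEMeasurable (fun x => Q x / γ.rnDeriv ν x) γ := by fun_prop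
  have hle := (lintegral_div_rnDeriv_le hγ hQ).trans hQ₁
  have hk : Integrable (fun x => (Q x / γ.rnDeriv ν x).toReal) γ :=
    integrable_toReal_of_lintegral_ne_top hm (ne_top_of_le_ne_top ENNReal.one_ne_top hle)
  have hk₁ : ∫ x, ((Q x / γ.rnDeriv ν x).toReal - 1) ∂γ ≤ 0 := by
    rw [integral_sub hk (integrable_const 1), integral_const, probReal_univ, one_smul, sub_nonpos,
      integral_toReal hm (ae_lt_top' hm (ne_top_of_le_ne_top ENNReal.one_ne_top hle))]
    exact ENNReal.toReal_le_of_le_ofReal zero_le_one (by rwa [ENNReal.ofReal_one])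
  have hlog : ∀ᵐ x ∂γ, Real.log (Q x).toReal ≤
      llr γ ν x + ((Q x / γ.rnDeriv ν x).toReal - 1) := by
    filter_upwards [hQ₀, hγ.ae_le (ae_lt_top hQ (ne_top_of_le_ne_top ENNReal.one_ne_top hQ₁)),
      Measure.rnDeriv_pos hγ, hγ.ae_le (Measure.rnDeriv_ne_top γ ν)] with x h₀ ht hr₀ hrt
    exact log_toReal_le_log_toReal_add h₀ ht.ne hr₀.ne' hrt
  rw [relEntropy_eq_extIntegral hγ]
  calc extIntegral γ (fun x => Real.log (Q x).toReal)
      ≤ extIntegral γ (llr γ ν)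
        + ((∫ x, ((Q x / γ.rnDeriv ν x).toReal - 1) ∂γ : ℝ) : EReal) :=
        extIntegral_le_add hQ.ennreal_toReal.log.aestronglyMeasurable
          (stronglyMeasurable_llr γ ν).aestronglyMeasurable (hk.sub (integrable_const 1)) hlog
    _ ≤ extIntegral γ (llr γ ν) := add_le_of_nonpos_right (EReal.coe_nonpos.2 hk₁)

theorem integral_le_relEntropy [IsProbabilityMeasure γ] [SigmaFinite ν] (hγ : γ ≪ ν)
    {g : X → ℝ} (hg : Measurable g) (hg₁ : ∫⁻ x, ENNReal.ofReal (Real.exp (g x)) ∂ν ≤ 1)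
    (hgi : Integrable g γ) : ((∫ x, g x ∂γ : ℝ) : EReal) ≤ relEntropy γ ν := by
  have hgibbs := extIntegral_log_le_relEntropy hγ hg.exp.ennreal_ofReal
    (ae_of_all _ fun x => (ENNReal.ofReal_pos.2 (Real.exp_pos _)).ne') hg₁
  simp only [ENNReal.toReal_ofReal (Real.exp_pos _).le, Real.log_exp] at hgibbs
  rwa [extIntegral_eq_integral hgi] at hgibbs

variable {Y Z : Type*} [MeasurableSpace Y] [MeasurableSpace Z] {κ : Measure Y} {η : Measure Z}
  {Φ : X → Y × Z}

lemma fst_map_absolutelyContinuous (hΦ : MeasurePreserving Φ ν (κ.prod η)) (hγ : γ ≪ ν) :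
    (γ.map Φ).fst ≪ κ :=
  ((hγ.map hΦ.measurable).trans hΦ.map_eq.absolutelyContinuous).map measurable_fst |>.trans
    Measure.quasiMeasurePreserving_fst.absolutelyContinuous

theorem relEntropy_fst_add_integral_le [IsProbabilityMeasure γ] [SigmaFinite ν]
    [SigmaFinite κ] [SigmaFinite η] (hΦ : MeasurePreserving Φ ν (κ.prod η)) (hγ : γ ≪ ν)
    {g : Z → ℝ} (hg : Measurable g)
    (hg₁ : ∫⁻ z, ENNReal.ofReal (Real.exp (g z)) ∂η ≤ 1)
    (hgi : Integrable (fun x => g (Φ x).2) γ) :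
    relEntropy (γ.map Φ).fst κ + ((∫ x, g (Φ x).2 ∂γ : ℝ) : EReal) ≤ relEntropy γ ν := by
  have hΦm := hΦ.measurable
  have hac := fst_map_absolutelyContinuous hΦ hγ
  have hprob := Measure.isProbabilityMeasure_map (μ := γ) hΦm.aemeasurable
  set ρ := (γ.map Φ).fst.rnDeriv κ
  have hρm : Measurable ρ := Measure.measurable_rnDeriv _ _
  set Q : X → ℝ≥0∞ := fun x => ρ (Φ x).1 * ENNReal.ofReal (Real.exp (g (Φ x).2)) with hQ
  have hQm : Measurable Q := by fun_prop
  have hpos : ∀ᵐ x ∂γ, 0 < ρ (Φ x).1 ∧ ρ (Φ x).1 ≠ ⊤ := by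
    have := (Measure.rnDeriv_pos hac).and (hac.ae_le (Measure.rnDeriv_ne_top (γ.map Φ).fst κ))
    exact ae_of_ae_map hΦm.aemeasurable (ae_of_ae_map measurable_fst.aemeasurable this)
  have hQ₁ : ∫⁻ x, Q x ∂ν ≤ 1 := by
    rw [hΦ.lintegral_comp (f := fun q : Y × Z => ρ q.1 * ENNReal.ofReal (Real.exp (g q.2)))
      (by fun_prop), lintegral_prod_mul hρm.aemeasurable hg.exp.ennreal_ofReal.aemeasurable]
    exact mul_le_one' (Measure.lintegral_rnDeriv_le.trans_eq measure_univ) hg₁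
  have hlog : ∀ᵐ x ∂γ, llr (γ.map Φ).fst κ (Φ x).1 ≤ Real.log (Q x).toReal + -g (Φ x).2 := by
    filter_upwards [hpos] with x hx
    rw [hQ, ENNReal.toReal_mul, ENNReal.toReal_ofReal (Real.exp_pos _).le,
      Real.log_mul (ENNReal.toReal_pos hx.1.ne' hx.2).ne' (Real.exp_pos _).ne', Real.log_exp, llr,
      add_neg_cancel_right]
  have hshift : relEntropy (γ.map Φ).fst κ ≤ extIntegral γ (fun x => Real.log (Q x).toReal)
      + ((∫ x, -g (Φ x).2 ∂γ : ℝ) : EReal) := by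
    have hL := measurable_llr (γ.map Φ).fst κ
    rw [relEntropy_eq_extIntegral hac, extIntegral_fst_map hΦm hL]
    exact extIntegral_le_add (hL.comp hΦm.fst).aestronglyMeasurable
      hQm.ennreal_toReal.log.aestronglyMeasurable hgi.neg hlog
  have hQ₀ : ∀ᵐ x ∂γ, Q x ≠ 0 := hpos.mono fun x hx =>
    mul_ne_zero hx.1.ne' (ENNReal.ofReal_pos.2 (Real.exp_pos _)).ne'
  calc relEntropy (γ.map Φ).fst κ + ((∫ x, g (Φ x).2 ∂γ : ℝ) : EReal)
      ≤ extIntegral γ (fun x => Real.log (Q x).toReal) + ((∫ x, -g (Φ x).2 ∂γ : ℝ) : EReal)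
        + ((∫ x, g (Φ x).2 ∂γ : ℝ) : EReal) := add_le_add_left hshift _
    _ = extIntegral γ (fun x => Real.log (Q x).toReal) := by
      rw [add_assoc, ← EReal.coe_add, integral_neg, neg_add_cancel, EReal.coe_zero, add_zero]
    _ ≤ relEntropy γ ν := extIntegral_log_le_relEntropy hγ hQm hQ₀ hQ₁

end Entropy

section Gaussian

variable {d : ℕ} {m s : ℝ}

/-- The logarithm of the centered Gaussian density with covariance `s • id`. -/
def logGauss (s : ℝ) (w : Rd d) : ℝ :=
  -((d : ℝ) / 2) * Real.log (2 * Real.pi * s) - ‖w‖ ^ 2 / (2 * s)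

@[fun_prop]
lemma measurable_logGauss (s : ℝ) : Measurable (logGauss (d := d) s) := by
  unfold logGauss; fun_prop

lemma lintegral_exp_logGauss (hs : 0 < s) :
    ∫⁻ w : Rd d, ENNReal.ofReal (Real.exp (logGauss s w)) = 1 := by
  have hdensity : ∀ w : Rd d, Real.exp (logGauss s w) =
      ((2 * Real.pi * s) ^ ((d : ℝ) / 2))⁻¹ * Real.exp (-(1 / (2 * s)) * ‖w‖ ^ 2) := fun w => by
    rw [Real.rpow_def_of_pos (by positivity), ← Real.exp_neg, ← Real.exp_add, logGauss]
    congr 1; ring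
  have hgauss : ∫ w : Rd d, Real.exp (-(1 / (2 * s)) * ‖w‖ ^ 2) =
      (2 * Real.pi * s) ^ ((d : ℝ) / 2) := by
    rw [GaussianFourier.integral_rexp_neg_mul_sq_norm (by positivity), finrank_euclideanSpace_fin]
    congr 1; field_simp
  have hone : ∫ w : Rd d, Real.exp (logGauss s w) = 1 := by
    simp_rw [hdensity]
    rw [integral_const_mul, hgauss, inv_mul_cancel₀ (by positivity)]
  rw [← ofReal_integral_eq_lintegral_ofReal _ (ae_of_all _ fun _ => (Real.exp_pos _).le), hone,
    ENNReal.ofReal_one]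
  exact Integrable.of_integral_ne_zero (by rw [hone]; exact one_ne_zero)

lemma logGauss_eq (hd : 0 < d) (hm : 0 < m) (w : Rd d) :
    logGauss (2 * m / d) w =
      -((d : ℝ) / 2) * Real.log m + constC d + d / 2 - d / (2 * m) * (‖w‖ ^ 2 / 2) := by
  have : (0 : ℝ) < d := Nat.cast_pos.2 hd
  rw [logGauss, constC, show 2 * Real.pi * (2 * m / d) = m * (4 * Real.pi / d) by ring,
    show 4 * Real.pi * Real.exp 1 / d = 4 * Real.pi / d * Real.exp 1 by ring,
    Real.log_mul hm.ne' (by positivity), Real.log_mul (by positivity) (Real.exp_pos _).ne',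
    Real.log_exp]
  field_simp
  ring

variable {X : Type*} [MeasurableSpace X] {γ : Measure X} [IsProbabilityMeasure γ] {W : X → Rd d}

lemma integrable_logGauss_and_le_integral (hd : 0 < d) (hW : Measurable W) (hm : 0 < m)
    (h : ∫⁻ x, ENNReal.ofReal (‖W x‖ ^ 2 / 2) ∂γ ≤ ENNReal.ofReal m) :
    Integrable (fun x => logGauss (2 * m / d) (W x)) γ ∧
      -((d : ℝ) / 2) * Real.log m + constC d ≤ ∫ x, logGauss (2 * m / d) (W x) ∂γ := by
  have hnonneg : 0 ≤ᵐ[γ] fun x => ‖W x‖ ^ 2 / 2 := ae_of_all _ fun _ => by positivity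
  have hint : Integrable (fun x => ‖W x‖ ^ 2 / 2) γ := by
    refine ⟨by fun_prop, ?_⟩
    rw [hasFiniteIntegral_iff_ofReal hnonneg]
    exact h.trans_lt ENNReal.ofReal_lt_top
  have hle : ∫ x, ‖W x‖ ^ 2 / 2 ∂γ ≤ m := by
    rw [integral_eq_lintegral_of_nonneg_ae hnonneg hint.1]
    exact ENNReal.toReal_le_of_le_ofReal hm.le h
  simp only [logGauss_eq hd hm]
  refine ⟨(integrable_const _).sub (hint.const_mul _), ?_⟩
  rw [integral_sub (integrable_const _) (hint.const_mul _), integral_const, integral_const_mul,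
    probReal_univ, one_smul]
  have hhalf : d / (2 * m) * ∫ x, ‖W x‖ ^ 2 / 2 ∂γ ≤ d / 2 :=
    calc d / (2 * m) * ∫ x, ‖W x‖ ^ 2 / 2 ∂γ ≤ d / (2 * m) * m := by gcongr
      _ = d / 2 := by field_simp
  linarith

lemma lintegral_norm_sq_ne_zero (hd : 0 < d) (hW : Measurable W) (hγ : γ.map W ≪ volume) :
    ∫⁻ x, ENNReal.ofReal (‖W x‖ ^ 2 / 2) ∂γ ≠ 0 := by
  have : Nonempty (Fin d) := ⟨⟨0, hd⟩⟩
  intro hzero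
  rw [lintegral_eq_zero_iff (by fun_prop)] at hzero
  have hne : ∀ᵐ x ∂γ, W x ≠ 0 := ae_of_ae_map hW.aemeasurable (hγ.ae_le (Measure.ae_ne volume 0))
  obtain ⟨x, hx, hx'⟩ := (hzero.and hne).exists
  have : 0 < ‖W x‖ := norm_pos_iff.2 hx'
  exact (ENNReal.ofReal_pos.2 (by positivity)).ne' hx

-- `g` is the logarithm of the Gaussian density of second moment `2M`.
lemma exists_exp_lintegral_eq_one_and_le_integral (hd : 0 < d) (hW : Measurable W)
    (hγ : γ.map W ≪ volume) {M : ℝ≥0∞} (hM : M ≠ ⊤)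
    (h : ∫⁻ x, ENNReal.ofReal (‖W x‖ ^ 2 / 2) ∂γ ≤ M) :
    ∃ g : Rd d → ℝ, Measurable g ∧ ∫⁻ w, ENNReal.ofReal (Real.exp (g w)) = 1 ∧
      Integrable (fun x => g (W x)) γ ∧
      ((-((d : ℝ) / 2) : ℝ) : EReal) * ENNReal.log M + (constC d : EReal) ≤
        ((∫ x, g (W x) ∂γ : ℝ) : EReal) := by
  have : (0 : ℝ) < d := Nat.cast_pos.2 hd
  have hm : 0 < M.toReal :=
    ENNReal.toReal_pos (ne_bot_of_le_ne_bot (lintegral_norm_sq_ne_zero hd hW hγ) h) hM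
  have hM' : M = ENNReal.ofReal M.toReal := (ENNReal.ofReal_toReal hM).symm
  obtain ⟨hint, hle⟩ := integrable_logGauss_and_le_integral hd hW hm (hM' ▸ h)
  refine ⟨logGauss (2 * M.toReal / d), measurable_logGauss _,
    lintegral_exp_logGauss (by positivity), hint, ?_⟩
  rw [hM', ENNReal.log_ofReal_of_pos hm, ← hM', ← EReal.coe_mul, ← EReal.coe_add]
  exact EReal.coe_le_coe_iff.2 hle

lemma map_sub_const_absolutelyContinuous {μ : Measure (Rd d)} (hμ : μ ≪ volume) (c : Rd d) :
    μ.map (fun x => x - c) ≪ volume :=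
  (hμ.map (by fun_prop)).trans (measurePreserving_sub_right volume c).map_eq.absolutelyContinuous

theorem le_diffEntropy_of_lintegral_norm_sub_sq_le {μ : Measure (Rd d)} [IsProbabilityMeasure μ]
    (hd : 0 < d) (hμ : μ ≪ volume) (c : Rd d) {V : ℝ≥0∞} (hV : V ≠ ⊤)
    (h : ∫⁻ x, ENNReal.ofReal (‖x - c‖ ^ 2 / 2) ∂μ ≤ V) :
    ((-((d : ℝ) / 2) : ℝ) : EReal) * ENNReal.log V + (constC d : EReal) ≤ diffEntropy μ := by
  obtain ⟨g, hg, hg₁, hgi, hle⟩ := exists_exp_lintegral_eq_one_and_le_integral hd (by fun_prop)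
    (map_sub_const_absolutelyContinuous hμ c) hV h
  refine hle.trans (integral_le_relEntropy hμ (by fun_prop) ?_ hgi)
  rw [lintegral_sub_right_eq_self fun x => ENNReal.ofReal (Real.exp (g x)), hg₁]

end Gaussian

section NearGraph

variable {d : ℕ} {γ : Measure (Rd d × Rd d)} {T : Rd d → Rd d} {M : ℝ≥0∞}

lemma fst_map_mintyShear (hT : Measurable T) : (γ.map (mintyShear T)).fst = mintyMarginal γ := by
  rw [mintyMarginal, Measure.fst, Measure.fst,
    Measure.map_map measurable_fst (measurePreserving_mintyShear hT).measurable,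
    Measure.map_map measurable_fst continuous_minty.measurable]
  rfl

lemma map_mintyShear_snd_absolutelyContinuous (hT : Measurable T) (hγ : γ ≪ volume) :
    γ.map (fun p => (mintyShear T p).2) ≪ volume := by
  have hΦ := measurePreserving_mintyShear hT
  exact (hγ.map hΦ.measurable.snd).trans (Measure.quasiMeasurePreserving_snd.comp
    hΦ.quasiMeasurePreserving).absolutelyContinuous

lemma lintegral_mintyMarginal_norm_sub_sq :
    ∫⁻ u, ENNReal.ofReal (‖u - (Real.sqrt 2)⁻¹ • ∫ q, (q.1 + q.2) ∂γ‖ ^ 2 / 2) ∂mintyMarginal γ =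
      ENNReal.ofReal (1 / 4) * sigmaSum γ ^ 2 := by
  rw [sigmaSum, ← ENNReal.rpow_natCast, ← ENNReal.rpow_mul, Nat.cast_ofNat,
    one_div_mul_cancel two_ne_zero, ENNReal.rpow_one,
    ← lintegral_const_mul' _ _ ENNReal.ofReal_ne_top, mintyMarginal, Measure.fst,
    lintegral_map (by fun_prop) measurable_fst,
    lintegral_map (by fun_prop) continuous_minty.measurable]
  refine lintegral_congr fun p => ?_
  rw [minty, ← smul_sub, norm_inv_sqrt_two_smul_sq, ← ofReal_norm,
    ← ENNReal.ofReal_pow (norm_nonneg _), ← ENNReal.ofReal_mul (by norm_num)]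
  congr 1; ring

variable [IsProbabilityMeasure γ]

theorem le_diffEntropy_of_lintegral_mintyShear_le (hd : 0 < d) (hγ : γ ≪ volume)
    (hT : Measurable T)
    (h : ∫⁻ p, ENNReal.ofReal (‖(mintyShear T p).2‖ ^ 2 / 2) ∂γ ≤ M) :
    ((-((d : ℝ) / 2) : ℝ) : EReal) * ENNReal.log M + diffEntropy (mintyMarginal γ)
      + (constC d : EReal) ≤ diffEntropy γ := by
  rcases eq_or_ne M ⊤ with rfl | hM
  · have hd' : (0 : ℝ) < d := Nat.cast_pos.2 hd
    rw [ENNReal.log_top, EReal.coe_mul_top_of_neg (by linarith), EReal.bot_add, EReal.bot_add]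
    exact bot_le
  have hΦ := measurePreserving_mintyShear hT
  obtain ⟨g, hg, hg₁, hgi, hle⟩ := exists_exp_lintegral_eq_one_and_le_integral hd
    hΦ.measurable.snd (map_mintyShear_snd_absolutelyContinuous hT hγ) hM h
  rw [add_right_comm, add_comm]
  refine (add_le_add_right hle _).trans ?_
  rw [← fst_map_mintyShear hT]
  exact relEntropy_fst_add_integral_le hΦ hγ hg hg₁.le hgi

lemma isProbabilityMeasure_mintyMarginal : IsProbabilityMeasure (mintyMarginal γ) := by
  have := Measure.isProbabilityMeasure_map (μ := γ) continuous_minty.measurable.aemeasurable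
  rw [mintyMarginal]; infer_instance

lemma sigmaSum_ne_zero (hd : 0 < d) (hγ : γ ≪ volume) : sigmaSum γ ≠ 0 := by
  have := isProbabilityMeasure_mintyMarginal (γ := γ)
  have hac : mintyMarginal γ ≪ volume := fst_map_absolutelyContinuous measurePreserving_minty hγ
  intro h
  refine lintegral_norm_sq_ne_zero hd (by fun_prop) (map_sub_const_absolutelyContinuous hac _)
    (lintegral_mintyMarginal_norm_sub_sq.trans ?_)
  rw [h, zero_pow two_ne_zero, mul_zero]

lemma entropyPower_le_of_le_diffEntropy {X : Type*} [MeasureSpace X] {μ : Measure X} (k : ℕ)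
    {K : ℝ} (h : (K : EReal) ≤ diffEntropy μ) :
    entropyPower k μ ≤
      ENNReal.ofReal (1 / (2 * Real.pi * Real.exp 1) * Real.exp (-(2 / (k : ℝ)) * K)) := by
  have hk : ((-(2 / (k : ℝ)) : ℝ) : EReal) ≤ 0 :=
    EReal.coe_nonpos.2 (neg_nonpos.2 (by positivity))
  rw [ENNReal.ofReal_mul (by positivity), ← EReal.exp_coe, EReal.coe_mul, entropyPower]
  gcongr _ * EReal.exp ?_
  simpa only [mul_comm] using EReal.mul_le_mul_of_nonpos_right h hk

lemma exp_entropyPower_bound (hd : 0 < d) {m σ : ℝ} (hm : 0 < m) (hσ : 0 < σ) :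
    1 / (2 * Real.pi * Real.exp 1) * Real.exp (-(2 / ((2 * d : ℕ) : ℝ)) *
      (-((d : ℝ) / 2) * Real.log m + (-((d : ℝ) / 2) * Real.log (1 / 4 * σ ^ 2) + constC d)
        + constC d)) = σ / d * m ^ (1 / 2 : ℝ) := by
  have : (0 : ℝ) < d := Nat.cast_pos.2 hd
  have hexponent : -(2 / ((2 * d : ℕ) : ℝ)) *
      (-((d : ℝ) / 2) * Real.log m + (-((d : ℝ) / 2) * Real.log (1 / 4 * σ ^ 2) + constC d)
        + constC d) =
      Real.log (σ / 2) + Real.log (4 * Real.pi * Real.exp 1 / d) + Real.log m * (1 / 2) := by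
    rw [constC, show 1 / 4 * σ ^ 2 = (σ / 2) ^ 2 by ring, Real.log_pow]
    push_cast
    field_simp
    ring
  rw [hexponent, Real.exp_add, Real.exp_add, Real.exp_log (by positivity),
    Real.exp_log (by positivity), ← Real.rpow_def_of_pos hm]
  field_simp
  ring

lemma entropyPower_le_of_sigmaSum_ne_top (hd : 0 < d) (hγ : γ ≪ volume) (hT : Measurable T)
    (hM₀ : M ≠ 0) (hM : M ≠ ⊤) (hσ₀ : sigmaSum γ ≠ 0) (hσ : sigmaSum γ ≠ ⊤)
    (h : ∫⁻ p, ENNReal.ofReal (‖(mintyShear T p).2‖ ^ 2 / 2) ∂γ ≤ M) :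
    entropyPower (2 * d) γ ≤ sigmaSum γ / (d : ℝ≥0∞) * M ^ (1 / 2 : ℝ) := by
  have := isProbabilityMeasure_mintyMarginal (γ := γ)
  have hac : mintyMarginal γ ≪ volume := fst_map_absolutelyContinuous measurePreserving_minty hγ
  have hvar := lintegral_mintyMarginal_norm_sub_sq (γ := γ)
  have hgraph := le_diffEntropy_of_lintegral_mintyShear_le hd hγ hT h
  have hd' : (0 : ℝ) < d := Nat.cast_pos.2 hd
  have hm := ENNReal.toReal_pos hM₀ hM
  have hs := ENNReal.toReal_pos hσ₀ hσ
  rw [← ENNReal.ofReal_toReal hσ] at hvar ⊢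
  rw [← ENNReal.ofReal_toReal hM] at hgraph ⊢
  set m := M.toReal
  set σ := (sigmaSum γ).toReal
  rw [← ENNReal.ofReal_pow hs.le, ← ENNReal.ofReal_mul (by norm_num)] at hvar
  have hmarginal :=
    le_diffEntropy_of_lintegral_norm_sub_sq_le hd hac _ ENNReal.ofReal_ne_top hvar.le
  rw [ENNReal.log_ofReal_of_pos (by positivity)] at hgraph hmarginal
  have hbound := entropyPower_le_of_le_diffEntropy (2 * d)
    (K := -((d : ℝ) / 2) * Real.log m + (-((d : ℝ) / 2) * Real.log (1 / 4 * σ ^ 2) + constC d)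
        + constC d) <| by
    refine le_trans ?_ hgraph
    push_cast
    gcongr
    exact_mod_cast hmarginal
  rwa [exp_entropyPower_bound hd hm hs, ENNReal.ofReal_mul (by positivity),
    ENNReal.ofReal_div_of_pos hd', ENNReal.ofReal_natCast, ← ENNReal.ofReal_rpow_of_pos hm]
      at hbound

theorem entropyPower_le_of_lintegral_mintyShear_le (hd : 0 < d) (hγ : γ ≪ volume)
    (hT : Measurable T)
    (h : ∫⁻ p, ENNReal.ofReal (‖(mintyShear T p).2‖ ^ 2 / 2) ∂γ ≤ M) :
    entropyPower (2 * d) γ ≤ sigmaSum γ / (d : ℝ≥0∞) * M ^ (1 / 2 : ℝ) := by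
  have hM₀ : M ≠ 0 := ne_bot_of_le_ne_bot (lintegral_norm_sq_ne_zero hd
    (measurePreserving_mintyShear hT).measurable.snd
    (map_mintyShear_snd_absolutelyContinuous hT hγ)) h
  have hσ₀ := sigmaSum_ne_zero hd hγ
  have hd' : (d : ℝ≥0∞) ≠ ⊤ := ENNReal.natCast_ne_top d
  rcases eq_or_ne M ⊤ with rfl | hM
  · rw [ENNReal.top_rpow_of_pos (by norm_num), ENNReal.mul_top (ENNReal.div_ne_zero.2 ⟨hσ₀, hd'⟩)]
    exact le_top
  rcases eq_or_ne (sigmaSum γ) ⊤ with hσ | hσ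
  · rw [hσ, ENNReal.top_div_of_ne_top hd', ENNReal.top_mul (by simp [hM₀, hM])]
    exact le_top
  exact entropyPower_le_of_sigmaSum_ne_top hd hγ hT hM₀ hM hσ₀ hσ h

end NearGraph

end QuadraticOT

end

open QuadraticOT in
theorem proposition3p4_general {d : ℕ} (hd : 0 < d) {φ ψ : Rd d → EReal}
    (hφψ : ∀ x y, φ x + ψ y ≤ (quadCost x y : EReal))
    {γ₀ : Measure (Rd d × Rd d)} {Γ : Set (Rd d × Rd d)} (hΓ : IsMonotoneSet Γ)
    (hγ₀ : ∀ᵐ p ∂γ₀, p ∈ Γ) (γ : Measure (Rd d × Rd d)) [IsProbabilityMeasure γ]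
    (hγ : γ ≪ volume) :
    ((-((d : ℝ) / 2) : ℝ) : EReal) * ENNReal.log (gapIntegral φ ψ γ)
        + diffEntropy (mintyMarginal γ) + (constC d : EReal) ≤ diffEntropy γ ∧
    ((-((d : ℝ) / 2) : ℝ) : EReal) * ENNReal.log (W2sq γ γ₀)
        + diffEntropy (mintyMarginal γ) + (constC d : EReal) ≤ diffEntropy γ ∧
    entropyPower (2 * d) γ ≤ sigmaSum γ / (d : ℝ≥0∞) * gapIntegral φ ψ γ ^ (1 / 2 : ℝ) ∧
    entropyPower (2 * d) γ ≤ sigmaSum γ / (d : ℝ≥0∞) * W2 γ γ₀ := by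
  obtain ⟨T, hT, hgap⟩ := exists_lipschitzWith_le_dualityGap hφψ
  obtain ⟨S, hS, hgraph⟩ := hΓ.exists_lipschitzWith
  have hE : ∫⁻ p, ENNReal.ofReal (‖(mintyShear T p).2‖ ^ 2 / 2) ∂γ ≤ gapIntegral φ ψ γ :=
    lintegral_mono hgap
  have hW : ∫⁻ p, ENNReal.ofReal (‖(mintyShear S p).2‖ ^ 2 / 2) ∂γ ≤ W2sq γ γ₀ :=
    lintegral_norm_mintyShear_snd_sq_le_W2sq hS (hγ₀.mono hgraph) γ
  have hTm := hT.continuous.measurable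
  have hSm := hS.continuous.measurable
  exact ⟨le_diffEntropy_of_lintegral_mintyShear_le hd hγ hTm hE,
    le_diffEntropy_of_lintegral_mintyShear_le hd hγ hSm hW,
    entropyPower_le_of_lintegral_mintyShear_le hd hγ hTm hE,
    entropyPower_le_of_lintegral_mintyShear_le hd hγ hSm hW⟩

theorem proposition3p4 {d : ℕ} (hd : 0 < d)
    (μ₀ μ₁ : MeasureTheory.Measure (QuadraticOT.Rd d))
    (hμ₀ : QuadraticOT.IsP2 μ₀) (hμ₁ : QuadraticOT.IsP2 μ₁)
    (φ ψ : QuadraticOT.Rd d → EReal)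
    (hφψ : QuadraticOT.IsKantorovichPair μ₀ μ₁ φ ψ)
    (γ₀ : MeasureTheory.Measure (QuadraticOT.Rd d × QuadraticOT.Rd d))
    (hγ₀ : QuadraticOT.IsOptimalPlan μ₀ μ₁ γ₀)
    (γ : MeasureTheory.Measure (QuadraticOT.Rd d × QuadraticOT.Rd d))
    [MeasureTheory.IsProbabilityMeasure γ]
    (hγ : γ ≪ MeasureTheory.volume) :
    ((-((d : ℝ) / 2) : ℝ) : EReal) * ENNReal.log (QuadraticOT.gapIntegral φ ψ γ)
        + QuadraticOT.diffEntropy (QuadraticOT.mintyMarginal γ)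
        + (QuadraticOT.constC d : EReal) ≤ QuadraticOT.diffEntropy γ ∧
    ((-((d : ℝ) / 2) : ℝ) : EReal) * ENNReal.log (QuadraticOT.W2sq γ γ₀)
        + QuadraticOT.diffEntropy (QuadraticOT.mintyMarginal γ)
        + (QuadraticOT.constC d : EReal) ≤ QuadraticOT.diffEntropy γ ∧
    QuadraticOT.entropyPower (2 * d) γ
      ≤ QuadraticOT.sigmaSum γ / (d : ENNReal) * QuadraticOT.gapIntegral φ ψ γ ^ (1 / 2 : ℝ) ∧
    QuadraticOT.entropyPower (2 * d) γ
      ≤ QuadraticOT.sigmaSum γ / (d : ENNReal) * QuadraticOT.W2 γ γ₀ := by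
  have hle x y : φ x + ψ y ≤ (QuadraticOT.quadCost x y : EReal) :=
    EReal.add_le_of_le_sub ((hφψ.left_eq x).trans_le (iInf_le _ y))
  exact proposition3p4_general hd hle (hγ₀.isMonotoneSet_support hμ₀ hμ₁) Measure.support_mem_ae
    γ hγ
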